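/- Let $G$ be a compact Hausdorff topological group (for instance a compact Lie group or a finite group), let $g\mapsto U_g$ be a continuous (in general projective) unitary representation of $G$ on a finite-dimensional complex Hilbert space $H$, and let $(G_i)_{i\in I}$ be a finite family of closed subgroups of $G$. Decompose $U$ into irreducible representations, $H=\bigoplus_{\mu\in S} H_\mu\otimes\mathbb C^{m_\mu}$, $d_\mu=\dim H_\mu$, where $S$ is the set of the equivalence classes of irreducible representations that occur and $m_\mu\ge 1$ are their multiplicities, and let $T^\mu_{kl}$ ($1\le k,l\le m_\mu$) be the operator $\mathbf 1_{H_\mu}\otimes |k\rangle\langle l|$ on $H_\mu\otimes\mathbb C^{m_\mu}$, extended by $0$ to $H$. Likewise, for each $i\in I$, decompose the restriction of $U$ to $G_i$: $H=\bigoplus_{\nu\in S_i}H_{i,\nu}\otimes\mathbb C^{m_{i,\nu}}$, and let $\Pi_{i,\nu}$ be the projection onto $H_{i,\nu}\otimes\mathbb C^{m_{i,\nu}}$. Let $\mathcal D$ be the convex set of the block operators $A=\bigoplus_{i\in I,\,\nu\in S_i}A_{i,\nu}$, with $A_{i,\nu}$ an operator on $\mathbb C^{m_{i,\nu}}$, such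 that $A\ge 0$ and $$\sum_{i\in I}\sum_{\nu\in S_i}\operatorname{Tr}\bigl[S^\mu_{kl,(i,\nu)}A_{i,\nu}\bigr]=\delta_{kl}\,d_\mu\quad\text{for all }\mu\in S,\ 1\le k,l\le m_\mu,\qquad S^\mu_{kl,(i,\nu)}=\operatorname{Tr}_{H_{i,\nu}}\bigl[\Pi_{i,\nu}T^\mu_{kl}\bigr].$$ (1) If $A=\bigoplus_{i,\nu}X_{i,\nu}^\dagger X_{i,\nu}$ is an extreme point of $\mathcal D$, then $$\sum_{i\in I}\sum_{\nu\in S_i}\operatorname{rank}(X_{i,\nu})^2\le\sum_{\mu\in S}m_\mu^2 .$$ (2) Consider the POVMs $P$ on the disjoint union $\mathfrak X=\bigcup_{i\in I}G/G_i$ with values in the operators on $H$ that are covariant, $P(gB)=U_gP(B)U_g^\dagger$ for all $g\in G$ and all measurable $B\subseteq\mathfrak X$. Let $P$ be an extreme point of the convex set of these POVMs, with seeds $A_i=\bigoplus_{\nu\in S_i}\mathbf 1_{H_{i,\nu}}\otimes A_{i,\nu}$, that is, $P(B)=\sum_{i\in I}\int_{B\cap G/G_i}U_{g(x)}A_iU_{g(x)}^\dagger\,dx$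 for all measurable $B$, where $dx$ is the $G$-invariant probability measure on $G/G_i$ and $g(x)\in G$ is any representative of $x$. Then $$\sum_{i\in I}\sum_{\nu\in S_i}\operatorname{rank}(A_{i,\nu})^2\le\sum_{\mu\in S}m_\mu^2 .$$ -/

import Mathlib

open MeasureTheory
open scoped Matrix Kronecker Pointwise ComplexOrder

/-- The conjugation `u A u†` of an operator `A` by a unitary `u` of a Hilbert space. -/
noncomputable def conjUnitary {H : Type*} [NormedAddCommGroup H] [InnerProductSpace ℂ H]
    (u : H ≃ₗᵢ[ℂ] H) (A : H →L[ℂ] H) : H →L[ℂ] H :=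
  (u.toContinuousLinearEquiv : H →L[ℂ] H) ∘L A ∘L (u.symm.toContinuousLinearEquiv : H →L[ℂ] H)

/-- A continuous projective unitary representation of a topological group `G` on `H`: unitaries
`U g` with `U g U h = c(g,h) U (g h)`, `|c(g,h)| = 1`. Continuity is asked of the action on
operators `A ↦ U g A (U g)†`, which does not depend on the choice of the phases. -/
structure ProjectiveUnitaryRep (G : Type*) [Group G] [TopologicalSpace G]
    (H : Type*) [NormedAddCommGroup H] [InnerProductSpace ℂ H] where
  toFun : G → (H ≃ₗᵢ[ℂ] H)
  multiplier : ∀ g h : G, ∃ c : ℂ, ‖c‖ = 1 ∧ ∀ v : H, toFun g (toFun h v) = c • toFun (g * h) v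
  continuous_conj : ∀ A : H →L[ℂ] H, Continuous fun g => conjUnitary (toFun g) A

/-- A family of unitary matrices is irreducible if the space is nonzero and has no invariant
subspaces but the trivial ones. -/
def IsIrreducibleFamily {K : Type*} {n : ℕ} (W : K → Matrix.unitaryGroup (Fin n) ℂ) : Prop :=
  0 < n ∧ ∀ V : Submodule ℂ (Fin n → ℂ),
    (∀ h : K, ∀ v ∈ V, (W h : Matrix (Fin n) (Fin n) ℂ) *ᵥ v ∈ V) → V = ⊥ ∨ V = ⊤

/-- Two families of unitary matrices are equivalent if an invertible linear map intertwines them. -/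
def AreEquivalentFamilies {K : Type*} {n n' : ℕ} (W : K → Matrix.unitaryGroup (Fin n) ℂ)
    (W' : K → Matrix.unitaryGroup (Fin n') ℂ) : Prop :=
  ∃ T : (Fin n → ℂ) ≃ₗ[ℂ] (Fin n' → ℂ), ∀ (h : K) (v : Fin n → ℂ),
    T ((W h : Matrix (Fin n) (Fin n) ℂ) *ᵥ v) = (W' h : Matrix (Fin n') (Fin n') ℂ) *ᵥ T v

/-- A decomposition `H = ⨁_ν H_ν ⊗ ℂ^(m_ν)`, `V h = ⨁_ν W_ν h ⊗ 1`, of a unitary (projective)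
representation `V` into irreducible ones. `ι` is the set of the classes of irreducible
representations that occur, `dim ν = dim H_ν`, `mult ν = m_ν`, and
`basis ⟨ν, (p, k)⟩` is the orthonormal basis `e_p ⊗ e_k` of `⨁_ν H_ν ⊗ ℂ^(m_ν)`. -/
structure IrrepDecomposition {K : Type*} {H : Type*} [NormedAddCommGroup H]
    [InnerProductSpace ℂ H] (V : K → (H ≃ₗᵢ[ℂ] H)) where
  ι : Type
  [fintype : Fintype ι]
  [decEq : DecidableEq ι]
  dim : ι → ℕ
  mult : ι → ℕ
  mult_pos : ∀ ν, 0 < mult ν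
  irrep : ∀ ν, K → Matrix.unitaryGroup (Fin (dim ν)) ℂ
  irreducible : ∀ ν, IsIrreducibleFamily (irrep ν)
  inequivalent : ∀ ν ν', ν ≠ ν' → ¬ AreEquivalentFamilies (irrep ν) (irrep ν')
  basis : OrthonormalBasis (Σ ν, Fin (dim ν) × Fin (mult ν)) ℂ H
  decomposes : ∀ h : K, ((V h).toLinearEquiv : H →ₗ[ℂ] H) =
    Matrix.toLin basis.toBasis basis.toBasis
      (Matrix.blockDiagonal' fun ν =>
        (irrep ν h : Matrix (Fin (dim ν)) (Fin (dim ν)) ℂ) ⊗ₖ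
          (1 : Matrix (Fin (mult ν)) (Fin (mult ν)) ℂ))

attribute [instance] IrrepDecomposition.fintype IrrepDecomposition.decEq

namespace IrrepDecomposition

section

variable {K : Type*} {H : Type*} [NormedAddCommGroup H] [InnerProductSpace ℂ H]
  {V : K → (H ≃ₗᵢ[ℂ] H)}

/-- Families `(B_ν)` of operators on the multiplicity spaces `ℂ^(m_ν)`. -/
abbrev Blocks (D : IrrepDecomposition V) : Type :=
  ∀ ν : D.ι, Matrix (Fin (D.mult ν)) (Fin (D.mult ν)) ℂ

/-- The operator `⨁_ν 1 ⊗ B_ν` on `H`. -/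
noncomputable def blockOp (D : IrrepDecomposition V) (B : D.Blocks) : H →ₗ[ℂ] H :=
  Matrix.toLin D.basis.toBasis D.basis.toBasis
    (Matrix.blockDiagonal' fun ν => (1 : Matrix (Fin (D.dim ν)) (Fin (D.dim ν)) ℂ) ⊗ₖ B ν)

/-- The intertwiner `T^μ_{kl}`: it maps the `l`-th copy of the irreducible representation `μ`
isometrically onto the `k`-th copy, by `e_p ⊗ e_l ↦ e_p ⊗ e_k`, and kills all other copies. -/
noncomputable def intertwiner (D : IrrepDecomposition V) (μ : D.ι) (k l : Fin (D.mult μ)) :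
    H →ₗ[ℂ] H :=
  D.blockOp (Pi.single μ (Matrix.single k l 1))

/-- The partial trace `Tr_{H_ν} [Π_ν O]` over `H_ν`, an operator on the multiplicity
space `ℂ^(m_ν)`, where `Π_ν` is the projection onto `H_ν ⊗ ℂ^(m_ν)`. -/
noncomputable def partialTrace (D : IrrepDecomposition V) (ν : D.ι) (O : H →ₗ[ℂ] H) :
    Matrix (Fin (D.mult ν)) (Fin (D.mult ν)) ℂ :=
  Matrix.of fun a b => ∑ p : Fin (D.dim ν),
    inner ℂ (D.basis ⟨ν, (p, a)⟩) (O (D.basis ⟨ν, (p, b)⟩))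

end

end IrrepDecomposition

section

variable {G : Type*} [Group G] [TopologicalSpace G]
  {H : Type*} [NormedAddCommGroup H] [InnerProductSpace ℂ H]
  {I : Type*}

/-- Block operators `A = ⨁_ω A_ω`, with `ω = (i, ν)`, `i ∈ I`, `ν ∈ S_i`. -/
abbrev BlockOperators {U : ProjectiveUnitaryRep G H} {K : I → Subgroup G}
    (Q : ∀ i, IrrepDecomposition fun h : K i => U.toFun h) : Type _ :=
  ∀ i, (Q i).Blocks

/-- The convex set of the block operators `A` such that `A ≥ 0` and
`Tr [S^μ_{kl} A] = δ_{kl} d_μ` for all `μ, k, l`, where `S^μ_{kl}` is the block operator with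
components `S^μ_{kl,(i,ν)} = Tr_{H_ν} [Π_ν T^μ_{kl}]`. -/
def normalizedBlocks [Fintype I] {U : ProjectiveUnitaryRep G H} {K : I → Subgroup G}
    (R : IrrepDecomposition U.toFun) (Q : ∀ i, IrrepDecomposition fun h : K i => U.toFun h) :
    Set (BlockOperators Q) :=
  {A | (∀ i ν, (A i ν).PosSemidef) ∧
    ∀ (μ : R.ι) (k l : Fin (R.mult μ)),
      ∑ i, ∑ ν, ((Q i).partialTrace ν (R.intertwiner μ k l) * A i ν).trace =
        if k = l then (R.dim μ : ℂ) else 0}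

/-- The outcome space `⋃_i G / G_i` (a disjoint union). -/
abbrev OutcomeSpace (K : I → Subgroup G) : Type _ := Σ i, G ⧸ K i

variable [MeasurableSpace G]

/-- The set of the covariant POVMs with outcomes in `⋃_i G / G_i`, as operator-valued measures. -/
def covariantPOVMs (U : ProjectiveUnitaryRep G H) (K : I → Subgroup G) :
    Set (VectorMeasure (OutcomeSpace K) (H →L[ℂ] H)) :=
  {P | (∀ B, MeasurableSet B → 0 ≤ P B ∧ P B ≤ 1) ∧ P Set.univ = 1 ∧
    ∀ (g : G) (B : Set (OutcomeSpace K)), MeasurableSet B →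
      P (g • B) = conjUnitary (U.toFun g) (P B)}

variable [IsTopologicalGroup G] [CompactSpace G] [BorelSpace G]

/-- The `G`-invariant probability measure on `G / K`, the image of the normalized Haar measure. -/
noncomputable def invariantMeasure (K : Subgroup G) : Measure (G ⧸ K) :=
  (Measure.haarMeasure (⊤ : TopologicalSpace.PositiveCompacts G)).map (QuotientGroup.mk : G → G ⧸ K)

/-- `P` has the seeds `A_i = ⨁_ν 1 ⊗ A_{i,ν}`, i.e. `P` has the operator density
`M(x) = U_{g(x)} A_i U_{g(x)}†` for `x ∈ G / G_i` with respect to the invariant measure,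
`g(x)` being a representative of `x`. The density does not depend on the representative,
because `A_i` commutes with `U_h` for all `h ∈ G_i`. -/
def HasSeeds [Fintype I] [FiniteDimensional ℂ H] {U : ProjectiveUnitaryRep G H} {K : I → Subgroup G}
    {Q : ∀ i, IrrepDecomposition fun h : K i => U.toFun h}
    (P : VectorMeasure (OutcomeSpace K) (H →L[ℂ] H)) (A : BlockOperators Q) : Prop :=
  ∀ B : Set (OutcomeSpace K), MeasurableSet B →
    P B = ∑ i, ∫ x in {x : G ⧸ K i | (⟨i, x⟩ : OutcomeSpace K) ∈ B},
      conjUnitary (U.toFun x.out) (LinearMap.toContinuousLinearMap ((Q i).blockOp (A i)))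
        ∂(invariantMeasure (K i))

end

/-! Both bounds come from one dimension count. Write the positive blocks as `X†X`. Near `X†X` there
is room in both directions along `X†MX`, `M` Hermitian, after scaling `M` down. These directions,
taken complex-linearly, form a space of dimension `∑ rank²`, while the normalization imposes `∑
m_μ²` linear conditions. If the ranks are too large, some nonzero direction satisfies all
homogeneous conditions. The conditions are compatible with adjoints, so this direction can be taken
Hermitian (`exists_perturbation_of_finrank_lt`, `exists_block_perturbation`). For the set of
normalized blocks this already contradicts extremality.

For POVMs the direction `D` is used as the seed of an operator-valued measure `N`. By covariance `N
univ` commutes with the representation; its traces against the intertwiners are those of the seeds,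
hence zero, and Schur's lemma gives `N univ = 0`. So `P + N` and `P - N` are covariant POVMs and
extremality gives `N = 0`. Finally, seeds of a positive measure are positive
(`HasSeeds.posSemidef`): applied to `N` and `-N`, this forces `D = 0`. -/

/-! ### Matrix ranks and perturbations inside the positive cone. -/

/-- A matrix of rank `r` is turned into the identity of size `r` by multiplication with suitable
matrices from both sides. -/
theorem Matrix.exists_mul_mul_eq_one_of_rank {F m n : Type*} [Field F] [Fintype m] [Fintype n]
    [DecidableEq m] [DecidableEq n] (X : Matrix m n F) :
    ∃ (C : Matrix (Fin X.rank) m F) (Z : Matrix n (Fin X.rank) F), C * X * Z = 1 := by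
  have hr : Module.finrank F (LinearMap.range X.mulVecLin) = X.rank := rfl
  let e : LinearMap.range X.mulVecLin ≃ₗ[F] (Fin X.rank → F) :=
    (Module.finBasisOfFinrankEq F _ hr).equivFun
  -- `s` is a section of `X` onto its range and `p` a projection onto that range; in the coordinates
  -- `e` they become `Z` and `C`.
  obtain ⟨s, hs⟩ := X.mulVecLin.rangeRestrict.exists_rightInverse_of_surjective
    (LinearMap.range_rangeRestrict _)
  obtain ⟨p, hp⟩ := (LinearMap.range X.mulVecLin).subtype.exists_leftInverse_of_injective
    (Submodule.ker_subtype _)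
  refine ⟨LinearMap.toMatrix' (e.toLinearMap ∘ₗ p),
    LinearMap.toMatrix' (s ∘ₗ e.symm.toLinearMap), ?_⟩
  apply Matrix.toLin'.injective
  refine LinearMap.ext fun v => ?_
  have h1 : X *ᵥ (s (e.symm v)) = (e.symm v : LinearMap.range X.mulVecLin) :=
    congrArg Subtype.val (LinearMap.congr_fun hs (e.symm v))
  have h2 : p (e.symm v : LinearMap.range X.mulVecLin) = e.symm v :=
    LinearMap.congr_fun hp (e.symm v)
  simp [Matrix.toLin'_mul, h1, h2]

section

open scoped Matrix.Norms.L2Operator MatrixOrder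

/-- A Hermitian matrix is dominated by a multiple of the identity. -/
theorem Matrix.IsHermitian.exists_posSemidef_smul_one_sub {n : Type*} [Fintype n] [DecidableEq n]
    {M : Matrix n n ℂ} (hM : M.IsHermitian) :
    ∃ c : ℝ, 0 ≤ c ∧ ∀ d : ℝ, c ≤ d → ((d : ℂ) • (1 : Matrix n n ℂ) - M).PosSemidef := by
  refine ⟨‖M‖, norm_nonneg _, fun d hd => ?_⟩
  have h1 : M ≤ algebraMap ℝ (Matrix n n ℂ) ‖M‖ := IsSelfAdjoint.le_algebraMap_norm_self hM
  have h2 : ((d : ℂ) • (1 : Matrix n n ℂ) - M) =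
      ((d - ‖M‖ : ℝ) : ℂ) • (1 : Matrix n n ℂ) + (algebraMap ℝ (Matrix n n ℂ) ‖M‖ - M) := by
    rw [Algebra.algebraMap_eq_smul_one]
    ext i j
    simp
    ring
  rw [h2]
  refine (Matrix.PosSemidef.one.smul ?_).add (Matrix.le_iff.mp h1)
  exact_mod_cast sub_nonneg.mpr hd

theorem Matrix.PosSemidef.exists_eq_conjTranspose_mul_self {n : Type*} [Fintype n]
    [DecidableEq n] {M : Matrix n n ℂ} (hM : M.PosSemidef) : ∃ X : Matrix n n ℂ, M = Xᴴ * X :=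
  CStarAlgebra.nonneg_iff_eq_star_mul_self.mp hM.nonneg

theorem Matrix.PosSemidef.eq_zero_of_neg {n : Type*} [Fintype n] {M : Matrix n n ℂ}
    (hM : M.PosSemidef) (hM' : (-M).PosSemidef) : M = 0 :=
  le_antisymm (Matrix.le_iff.mpr (by simpa using hM')) hM.nonneg

end

/-- If a linear map on families of matrices, with a kernel that is closed under adjoints, has
a target of dimension smaller than `∑ rank (X ω) ^ 2`, then `(X ω)ᴴ * X ω` can be moved in both
directions along a nonzero element of the kernel without leaving the positive cone. -/
theorem exists_perturbation_of_finrank_lt {Ω : Type*} [Fintype Ω] {n m : Ω → ℕ}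
    (X : ∀ ω, Matrix (Fin (n ω)) (Fin (m ω)) ℂ)
    {E : Type*} [AddCommGroup E] [Module ℂ E] [FiniteDimensional ℂ E]
    (L : (∀ ω, Matrix (Fin (m ω)) (Fin (m ω)) ℂ) →ₗ[ℂ] E)
    (hL : ∀ D, L D = 0 → L (fun ω => (D ω)ᴴ) = 0)
    (hlt : Module.finrank ℂ E < ∑ ω, (X ω).rank ^ 2) :
    ∃ D, D ≠ 0 ∧ L D = 0 ∧ ∀ ω, ((X ω)ᴴ * X ω + D ω).PosSemidef ∧
      ((X ω)ᴴ * X ω - D ω).PosSemidef := by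
  choose C Z hCZ using fun ω => (X ω).exists_mul_mul_eq_one_of_rank
  -- `X` alone may have dependent rows, so `B ↦ X†BX` need not be injective. Compressing by `C`
  -- leaves `rank X` independent rows, and `Z` recovers `B`.
  let Φ : (∀ ω, Matrix (Fin (X ω).rank) (Fin (X ω).rank) ℂ) →ₗ[ℂ]
      (∀ ω, Matrix (Fin (m ω)) (Fin (m ω)) ℂ) :=
    { toFun := fun B ω => (C ω * X ω)ᴴ * B ω * (C ω * X ω)
      map_add' := fun B B' => by funext ω; simp [Matrix.mul_add, Matrix.add_mul]
      map_smul' := fun c B => by funext ω; simp }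
  have hΦ : ∀ B ω, Φ B ω = (C ω * X ω)ᴴ * B ω * (C ω * X ω) := fun _ _ => rfl
  have hΦstar : ∀ B, Φ (fun ω => (B ω)ᴴ) = fun ω => (Φ B ω)ᴴ := fun B => by
    funext ω; simp [hΦ, Matrix.mul_assoc]
  have hΦinj : ∀ B, Φ B = 0 → B = 0 := fun B hB => by
    funext ω
    have h1 : (C ω * X ω * Z ω)ᴴ * B ω * (C ω * X ω * Z ω) = (Z ω)ᴴ * Φ B ω * Z ω := by
      simp only [hΦ, Matrix.conjTranspose_mul, Matrix.mul_assoc]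
    rw [hCZ, hB] at h1
    simpa using h1
  have hker : LinearMap.ker (L ∘ₗ Φ) ≠ ⊥ := by
    apply LinearMap.ker_ne_bot_of_finrank_lt
    rw [Module.finrank_pi_fintype]
    simpa [Module.finrank_matrix, pow_two] using hlt
  obtain ⟨B, hB, hB0⟩ := Submodule.exists_mem_ne_zero_of_ne_bot hker
  have hB1 : L (Φ B) = 0 := hB
  have hB2 : L (Φ fun ω => (B ω)ᴴ) = 0 := by rw [hΦstar]; exact hL _ hB1
  obtain ⟨N, hNherm, hN0, hLN⟩ : ∃ N : ∀ ω, Matrix (Fin (X ω).rank) (Fin (X ω).rank) ℂ,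
      (∀ ω, (N ω).IsHermitian) ∧ N ≠ 0 ∧ L (Φ N) = 0 := by
    -- The Hermitian part of `B` serves unless it vanishes; then `B` is anti-Hermitian and `I • B`
    -- is Hermitian and nonzero.
    by_cases h : B + (fun ω => (B ω)ᴴ) = 0
    · refine ⟨Complex.I • B, fun ω => ?_, smul_ne_zero Complex.I_ne_zero hB0, by simp [hB1]⟩
      have : (B ω)ᴴ = - B ω := (neg_eq_of_add_eq_zero_right (congrFun h ω)).symm
      simp [Matrix.IsHermitian, Matrix.conjTranspose_smul, this]
    · refine ⟨_, fun ω => ?_, h, by simp [hB1, hB2]⟩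
      simp [Matrix.IsHermitian, add_comm]
  have hMherm : ∀ ω, ((C ω)ᴴ * N ω * C ω).IsHermitian := fun ω =>
    Matrix.isHermitian_conjTranspose_mul_mul _ (hNherm ω)
  choose c hc0 hc using fun ω => (hMherm ω).exists_posSemidef_smul_one_sub
  choose c' hc'0 hc' using fun ω => (hMherm ω).neg.exists_posSemidef_smul_one_sub
  -- A single scale for all `ω` keeps the rescaled direction in the kernel of `L`; the summand 1
  -- keeps `d` positive if all bounds vanish. With `M = C†NC`, `X†X ± d⁻¹X†MX = d⁻¹X†(d ± M)X`.
  let d : ℝ := 1 + ∑ ω, (c ω + c' ω)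
  have hdle : ∀ ω, c ω + c' ω ≤ ∑ ω, (c ω + c' ω) := fun ω =>
    Finset.single_le_sum (f := fun ω => c ω + c' ω)
      (fun i _ => add_nonneg (hc0 i) (hc'0 i)) (Finset.mem_univ ω)
  have hd : 0 < d := by
    have := Finset.sum_nonneg (s := Finset.univ) fun i _ => add_nonneg (hc0 i) (hc'0 i)
    positivity
  have hdc : (d : ℂ) ≠ 0 := by exact_mod_cast hd.ne'
  have hdinv : (0 : ℂ) ≤ (d : ℂ)⁻¹ := by
    rw [← Complex.ofReal_inv]; exact_mod_cast (inv_pos.mpr hd).le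
  refine ⟨(d : ℂ)⁻¹ • Φ N, smul_ne_zero (inv_ne_zero hdc) fun h => hN0 (hΦinj N h),
    by simp [hLN], fun ω => ⟨?_, ?_⟩⟩
  · have h1 := ((hc' ω d (by dsimp only [d]; linarith [hdle ω, hc0 ω])).conjTranspose_mul_mul_same
      (X ω)).smul hdinv
    convert h1 using 1
    simp [hΦ, Matrix.mul_add, Matrix.add_mul, Matrix.mul_assoc]
    rw [← Complex.coe_smul, smul_smul, inv_mul_cancel₀ hdc, one_smul]
  · have h1 := ((hc ω d (by dsimp only [d]; linarith [hdle ω, hc'0 ω])).conjTranspose_mul_mul_same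
      (X ω)).smul hdinv
    convert h1 using 1
    simp [hΦ, Matrix.mul_sub, Matrix.sub_mul, Matrix.mul_assoc, smul_sub]
    rw [← Complex.coe_smul, smul_smul, inv_mul_cancel₀ hdc, one_smul]

/-! ### Block operators, partial traces and intertwiners. -/

namespace IrrepDecomposition

section

variable {K : Type*} {H : Type*} [NormedAddCommGroup H] [InnerProductSpace ℂ H]
  {V : K → (H ≃ₗᵢ[ℂ] H)}

theorem dim_pos (D : IrrepDecomposition V) (ν : D.ι) : 0 < D.dim ν := (D.irreducible ν).1

/-- The matrix of `⨁_ν 1 ⊗ B_ν` in the basis of the decomposition. -/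
theorem toMatrix_blockOp (D : IrrepDecomposition V) (B : D.Blocks) :
    LinearMap.toMatrix D.basis.toBasis D.basis.toBasis (D.blockOp B) =
      Matrix.blockDiagonal' fun ν => (1 : Matrix (Fin (D.dim ν)) (Fin (D.dim ν)) ℂ) ⊗ₖ B ν :=
  LinearMap.toMatrix_toLin _ _ _

theorem blockOp_add (D : IrrepDecomposition V) (B C : D.Blocks) :
    D.blockOp (B + C) = D.blockOp B + D.blockOp C := by
  simp only [blockOp, Pi.add_apply, Matrix.kronecker_add]
  rw [← map_add, ← Matrix.blockDiagonal'_add]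
  rfl

theorem blockOp_smul (D : IrrepDecomposition V) (c : ℂ) (B : D.Blocks) :
    D.blockOp (c • B) = c • D.blockOp B := by
  simp only [blockOp, Pi.smul_apply, Matrix.kronecker_smul]
  rw [← map_smul, ← Matrix.blockDiagonal'_smul]
  rfl

theorem blockOp_mul (D : IrrepDecomposition V) (B C : D.Blocks) :
    D.blockOp (B * C) = D.blockOp B ∘ₗ D.blockOp C := by
  simp only [blockOp]
  rw [← Matrix.toLin_mul, ← Matrix.blockDiagonal'_mul]
  simp [← Matrix.mul_kronecker_mul]

theorem blockOp_conjTranspose [FiniteDimensional ℂ H] (D : IrrepDecomposition V)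
    (B : D.Blocks) : D.blockOp (fun ν => (B ν)ᴴ) = LinearMap.adjoint (D.blockOp B) := by
  simp only [blockOp]
  rw [← Matrix.toLin_conjTranspose, Matrix.blockDiagonal'_conjTranspose]
  simp [Matrix.conjTranspose_kronecker]

/-- `⨁_ν 1 ⊗ B_ν` commutes with the representation. -/
theorem blockOp_commute (D : IrrepDecomposition V) (B : D.Blocks) (h : K) (v : H) :
    D.blockOp B (V h v) = V h (D.blockOp B v) := by
  have h1 : D.blockOp B ∘ₗ ((V h).toLinearEquiv : H →ₗ[ℂ] H) =
      ((V h).toLinearEquiv : H →ₗ[ℂ] H) ∘ₗ D.blockOp B := by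
    rw [D.decomposes h, blockOp, ← Matrix.toLin_mul, ← Matrix.toLin_mul,
      ← Matrix.blockDiagonal'_mul, ← Matrix.blockDiagonal'_mul]
    simp [← Matrix.mul_kronecker_mul]
  exact LinearMap.congr_fun h1 v

/-- `⨁_ν 1 ⊗ B_ν` is positive if and only if all the `B_ν` are. -/
theorem isPositive_blockOp_iff [FiniteDimensional ℂ H] (D : IrrepDecomposition V)
    (B : D.Blocks) : (D.blockOp B).IsPositive ↔ ∀ ν, (B ν).PosSemidef := by
  rw [← LinearMap.posSemidef_toMatrix_iff D.basis, toMatrix_blockOp]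
  constructor
  · intro h ν
    -- Fixing the basis vector 0 of `H_ν`, which exists since `dim_pos`, exhibits `B ν` as a
    -- principal submatrix.
    have h1 := h.submatrix fun a : Fin (D.mult ν) =>
      (⟨ν, (⟨0, D.dim_pos ν⟩, a)⟩ : Σ ν, Fin (D.dim ν) × Fin (D.mult ν))
    have h2 : (Matrix.blockDiagonal' fun ν =>
        (1 : Matrix (Fin (D.dim ν)) (Fin (D.dim ν)) ℂ) ⊗ₖ B ν).submatrix
        (fun a : Fin (D.mult ν) => ⟨ν, (⟨0, D.dim_pos ν⟩, a)⟩)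
        (fun a : Fin (D.mult ν) => ⟨ν, (⟨0, D.dim_pos ν⟩, a)⟩) = B ν := by
      ext a b
      simp [Matrix.blockDiagonal'_apply_eq]
    rwa [h2] at h1
  · intro h
    choose X hX using fun ν => (h ν).exists_eq_conjTranspose_mul_self
    have h1 : (fun ν => (1 : Matrix (Fin (D.dim ν)) (Fin (D.dim ν)) ℂ) ⊗ₖ B ν) =
        fun ν => ((1 : Matrix (Fin (D.dim ν)) (Fin (D.dim ν)) ℂ) ⊗ₖ X ν)ᴴ *
          ((1 : Matrix (Fin (D.dim ν)) (Fin (D.dim ν)) ℂ) ⊗ₖ X ν) := by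
      funext ν
      rw [hX ν, Matrix.conjTranspose_kronecker, ← Matrix.mul_kronecker_mul]
      simp
    rw [h1, Matrix.blockDiagonal'_mul, ← Matrix.blockDiagonal'_conjTranspose]
    exact Matrix.posSemidef_conjTranspose_mul_self _

/-- The partial traces represent `B ↦ Tr [O (⨁_ν 1 ⊗ B_ν)]`. -/
theorem trace_comp_blockOp (D : IrrepDecomposition V) (O : H →ₗ[ℂ] H) (B : D.Blocks) :
    LinearMap.trace ℂ H (O ∘ₗ D.blockOp B) = ∑ ν, (D.partialTrace ν O * B ν).trace := by
  rw [LinearMap.trace_eq_matrix_trace ℂ D.basis.toBasis,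
    LinearMap.toMatrix_comp _ D.basis.toBasis, toMatrix_blockOp]
  simp only [Matrix.trace, Matrix.diag, Matrix.mul_apply, Fintype.sum_sigma,
    Fintype.sum_prod_type, partialTrace, Matrix.of_apply, LinearMap.toMatrix_apply,
    Matrix.blockDiagonal'_apply, Matrix.kroneckerMap_apply]
  refine Finset.sum_congr rfl fun ν _ => ?_
  rw [Finset.sum_comm]
  refine Finset.sum_congr rfl fun a _ => ?_
  simp [Matrix.one_apply, OrthonormalBasis.repr_apply_apply]
  rw [Finset.sum_comm]
  simp [Finset.sum_mul]

/-- The intertwiners `T^μ_{kl}` detect the entries of the blocks. -/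
theorem trace_intertwiner_comp_blockOp (D : IrrepDecomposition V) (μ : D.ι)
    (k l : Fin (D.mult μ)) (B : D.Blocks) :
    LinearMap.trace ℂ H (D.intertwiner μ k l ∘ₗ D.blockOp B) = D.dim μ * B μ l k := by
  rw [intertwiner, ← blockOp_mul, LinearMap.trace_eq_matrix_trace ℂ D.basis.toBasis,
    toMatrix_blockOp, Matrix.trace_blockDiagonal']
  simp only [Matrix.trace_kronecker, Matrix.trace_one, Fintype.card_fin, Pi.mul_apply]
  rw [Finset.sum_eq_single μ]
  · simp [Matrix.trace_single_mul]
  · intro ν _ hν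
    simp [Pi.single_eq_of_ne hν]
  · simp

theorem intertwiner_adjoint [FiniteDimensional ℂ H] (D : IrrepDecomposition V) (μ : D.ι)
    (k l : Fin (D.mult μ)) :
    LinearMap.adjoint (D.intertwiner μ k l) = D.intertwiner μ l k := by
  rw [intertwiner, intertwiner, ← blockOp_conjTranspose]
  congr 1
  funext ν
  by_cases h : ν = μ
  · subst h; simp
  · simp [Pi.single_eq_of_ne h]

end

end IrrepDecomposition

/-- The trace of the adjoint is the conjugate of the trace. -/
theorem LinearMap.trace_adjoint {H : Type*} [NormedAddCommGroup H] [InnerProductSpace ℂ H]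
    [FiniteDimensional ℂ H] (O : H →ₗ[ℂ] H) :
    LinearMap.trace ℂ H (LinearMap.adjoint O) = star (LinearMap.trace ℂ H O) := by
  rw [LinearMap.trace_eq_matrix_trace ℂ (stdOrthonormalBasis ℂ H).toBasis,
    LinearMap.trace_eq_matrix_trace ℂ (stdOrthonormalBasis ℂ H).toBasis,
    LinearMap.toMatrix_adjoint, Matrix.trace_conjTranspose]

/-! ### Schur's lemma and the commutant of a representation. -/

/-- Schur's lemma: an intertwiner of irreducible families vanishes or is an equivalence. -/
theorem IsIrreducibleFamily.eq_zero_or_areEquivalentFamilies {K : Type*} {n n' : ℕ}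
    {W : K → Matrix.unitaryGroup (Fin n) ℂ} {W' : K → Matrix.unitaryGroup (Fin n') ℂ}
    (hW : IsIrreducibleFamily W) (hW' : IsIrreducibleFamily W') (A : Matrix (Fin n') (Fin n) ℂ)
    (hA : ∀ h, A * (W h : Matrix (Fin n) (Fin n) ℂ) = (W' h : Matrix (Fin n') (Fin n') ℂ) * A) :
    A = 0 ∨ AreEquivalentFamilies W W' := by
  have hA' : ∀ h v, A *ᵥ ((W h : Matrix (Fin n) (Fin n) ℂ) *ᵥ v) =
      (W' h : Matrix (Fin n') (Fin n') ℂ) *ᵥ (A *ᵥ v) := fun h v => by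
    rw [Matrix.mulVec_mulVec, hA, Matrix.mulVec_mulVec]
  have hker := hW.2 (LinearMap.ker A.mulVecLin) fun h v hv => by
    rw [LinearMap.mem_ker, Matrix.mulVecLin_apply] at hv ⊢
    rw [hA', hv, Matrix.mulVec_zero]
  have hrange := hW'.2 (LinearMap.range A.mulVecLin) fun h v hv => by
    obtain ⟨w, rfl⟩ := hv
    exact ⟨(W h : Matrix (Fin n) (Fin n) ℂ) *ᵥ w, hA' h w⟩
  have h0 : A.mulVecLin = 0 → A = 0 := fun h => by
    apply Matrix.toLin'.injective
    rw [map_zero]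
    exact h
  rcases hker with hker | hker
  · rcases hrange with hrange | hrange
    · exact Or.inl (h0 (LinearMap.range_eq_bot.mp hrange))
    · exact Or.inr ⟨LinearEquiv.ofBijective A.mulVecLin
        ⟨LinearMap.ker_eq_bot.mp hker, LinearMap.range_eq_top.mp hrange⟩, fun h v => hA' h v⟩
  · exact Or.inl (h0 (LinearMap.ker_eq_top.mp hker))

/-- Schur's lemma: the commutant of an irreducible family consists of the scalars. -/
theorem IsIrreducibleFamily.exists_eq_smul_one {K : Type*} {n : ℕ}
    {W : K → Matrix.unitaryGroup (Fin n) ℂ} (hW : IsIrreducibleFamily W)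
    (A : Matrix (Fin n) (Fin n) ℂ)
    (hA : ∀ h, A * (W h : Matrix (Fin n) (Fin n) ℂ) = (W h : Matrix (Fin n) (Fin n) ℂ) * A) :
    ∃ c : ℂ, A = c • 1 := by
  have : Nonempty (Fin n) := ⟨⟨0, hW.1⟩⟩
  obtain ⟨c, hc⟩ := Module.End.exists_eigenvalue (K := ℂ) (V := Fin n → ℂ) A.mulVecLin
  refine ⟨c, ?_⟩
  have htop := (hW.2 (Module.End.eigenspace A.mulVecLin c) fun h v hv => by
    rw [Module.End.mem_eigenspace_iff, Matrix.mulVecLin_apply] at hv ⊢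
    rw [Matrix.mulVec_mulVec, hA, ← Matrix.mulVec_mulVec, hv, Matrix.mulVec_smul]).resolve_left
      hc
  apply Matrix.toLin'.injective
  refine LinearMap.ext fun v => ?_
  have hv : v ∈ Module.End.eigenspace A.mulVecLin c := htop ▸ Submodule.mem_top
  rw [Module.End.mem_eigenspace_iff] at hv
  simpa using hv

namespace IrrepDecomposition

section

variable {K : Type*} {H : Type*} [NormedAddCommGroup H] [InnerProductSpace ℂ H]
  {V : K → (H ≃ₗᵢ[ℂ] H)}

/-- The commutant of a representation consists of the operators `⨁_ν 1 ⊗ B_ν`. -/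
theorem exists_eq_blockOp (D : IrrepDecomposition V) (O : H →ₗ[ℂ] H)
    (hO : ∀ h v, O (V h v) = V h (O v)) : ∃ B : D.Blocks, O = D.blockOp B := by
  set M := LinearMap.toMatrix D.basis.toBasis D.basis.toBasis O with hM
  have hcomm : ∀ h, M * (Matrix.blockDiagonal' fun ν =>
        (D.irrep ν h : Matrix (Fin (D.dim ν)) (Fin (D.dim ν)) ℂ) ⊗ₖ
          (1 : Matrix (Fin (D.mult ν)) (Fin (D.mult ν)) ℂ)) =
      (Matrix.blockDiagonal' fun ν =>
        (D.irrep ν h : Matrix (Fin (D.dim ν)) (Fin (D.dim ν)) ℂ) ⊗ₖ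
          (1 : Matrix (Fin (D.mult ν)) (Fin (D.mult ν)) ℂ)) * M := fun h => by
    have h1 : O ∘ₗ ((V h).toLinearEquiv : H →ₗ[ℂ] H) =
        ((V h).toLinearEquiv : H →ₗ[ℂ] H) ∘ₗ O := LinearMap.ext (hO h)
    have h2 := congrArg (LinearMap.toMatrix D.basis.toBasis D.basis.toBasis) h1
    rwa [LinearMap.toMatrix_comp _ D.basis.toBasis, LinearMap.toMatrix_comp _ D.basis.toBasis,
      D.decomposes h, LinearMap.toMatrix_toLin] at h2
  -- `S ν ν' k k'` is the part of `O` from copy `k'` of `ν'` to copy `k` of `ν`. Each such part is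
  -- an intertwiner, so Schur's lemma applies to it separately.
  let S : ∀ ν ν' : D.ι, Fin (D.mult ν) → Fin (D.mult ν') →
      Matrix (Fin (D.dim ν)) (Fin (D.dim ν')) ℂ := fun ν ν' k k' =>
    Matrix.of fun p p' => M ⟨ν, (p, k)⟩ ⟨ν', (p', k')⟩
  have hS : ∀ ν ν' k k' h, S ν ν' k k' * (D.irrep ν' h : Matrix _ _ ℂ) =
      (D.irrep ν h : Matrix _ _ ℂ) * S ν ν' k k' := fun ν ν' k k' h => by
    ext p p'
    have h1 := congrFun (congrFun (hcomm h) ⟨ν, (p, k)⟩) ⟨ν', (p', k')⟩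
    simp [Matrix.mul_apply, Fintype.sum_sigma, Fintype.sum_prod_type, Matrix.one_apply,
      Matrix.blockDiagonal'_apply] at h1
    exact h1
  have hdiag : ∀ ν (k k' : Fin (D.mult ν)), ∃ c : ℂ, S ν ν k k' = c • 1 := fun ν k k' =>
    (D.irreducible ν).exists_eq_smul_one _ fun h => hS ν ν k k' h
  choose c hc using hdiag
  refine ⟨fun ν => Matrix.of (c ν), ?_⟩
  apply (LinearMap.toMatrix D.basis.toBasis D.basis.toBasis).injective
  rw [toMatrix_blockOp, ← hM]
  ext ⟨ν, p, k⟩ ⟨ν', p', k'⟩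
  by_cases h : ν = ν'
  · subst h
    rw [Matrix.blockDiagonal'_apply_eq]
    have h1 := congrFun (congrFun (hc ν k k') p) p'
    simpa [S, mul_comm] using h1
  · rw [Matrix.blockDiagonal'_apply_ne _ _ _ h]
    have h1 := ((D.irreducible ν').eq_zero_or_areEquivalentFamilies (D.irreducible ν) _
      fun h => hS ν ν' k k' h).resolve_right (D.inequivalent ν' ν (Ne.symm h))
    exact congrFun (congrFun h1 p) p'

/-- An operator in the commutant that is orthogonal to all the intertwiners vanishes. -/
theorem eq_zero_of_trace_intertwiner_comp (D : IrrepDecomposition V) (O : H →ₗ[ℂ] H)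
    (hO : ∀ h v, O (V h v) = V h (O v))
    (htr : ∀ μ k l, LinearMap.trace ℂ H (D.intertwiner μ k l ∘ₗ O) = 0) : O = 0 := by
  obtain ⟨B, rfl⟩ := D.exists_eq_blockOp O hO
  -- Each trace is `dim μ` times one entry of `B`, and `dim μ ≠ 0`. The form `0 • B` lets
  -- `blockOp_smul` finish.
  have hB : B = (0 : ℂ) • B := by
    funext μ
    ext l k
    have h1 := htr μ k l
    rw [trace_intertwiner_comp_blockOp] at h1
    simpa [(D.dim_pos μ).ne'] using h1
  rw [hB, blockOp_smul, zero_smul]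

end

end IrrepDecomposition

/-! ### Extreme points and the bound for normalized blocks. -/

/-- `x` is the midpoint of `x + d` and `x - d`, so extremality identifies it with an endpoint. -/
theorem eq_zero_of_add_mem_of_sub_mem_of_mem_extremePoints {E : Type*} [AddCommGroup E]
    [Module ℝ E] {S : Set E} {x d : E} (hx : x ∈ Set.extremePoints ℝ S) (hadd : x + d ∈ S)
    (hsub : x - d ∈ S) : d = 0 := by
  have h := hx.2 hadd hsub ⟨1 / 2, 1 / 2, by norm_num, by norm_num, by norm_num, by module⟩
  simpa using h

section

variable {G : Type*} [Group G] [TopologicalSpace G]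
  {H : Type*} [NormedAddCommGroup H] [InnerProductSpace ℂ H] [FiniteDimensional ℂ H]
  {I : Type*} [Fintype I] {U : ProjectiveUnitaryRep G H} {K : I → Subgroup G}

/-- If the ranks of the blocks `X†X` are too large, then `X†X` can be moved in both directions
along a nonzero block operator without leaving the positive cone and without changing the traces
against the intertwiners. -/
theorem exists_block_perturbation (R : IrrepDecomposition U.toFun)
    (Q : ∀ i, IrrepDecomposition fun h : K i => U.toFun h) (n : ∀ i, (Q i).ι → ℕ)
    (X : ∀ i (ν : (Q i).ι), Matrix (Fin (n i ν)) (Fin ((Q i).mult ν)) ℂ)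
    (hlt : ∑ μ, R.mult μ ^ 2 < ∑ i, ∑ ν, (X i ν).rank ^ 2) :
    ∃ D : BlockOperators Q, D ≠ 0 ∧
      (∀ μ k l, ∑ i, LinearMap.trace ℂ H (R.intertwiner μ k l ∘ₗ (Q i).blockOp (D i)) = 0) ∧
      ∀ i ν, ((X i ν)ᴴ * X i ν + D i ν).PosSemidef ∧ ((X i ν)ᴴ * X i ν - D i ν).PosSemidef := by
  -- All homogeneous constraints form one linear map, on families indexed by the pairs `(i, ν)`.
  let L : (∀ ω : (Σ i, (Q i).ι), Matrix (Fin ((Q ω.1).mult ω.2)) (Fin ((Q ω.1).mult ω.2)) ℂ)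
      →ₗ[ℂ] R.Blocks :=
    { toFun := fun D μ => Matrix.of fun k l =>
        ∑ i, LinearMap.trace ℂ H (R.intertwiner μ k l ∘ₗ (Q i).blockOp fun ν => D ⟨i, ν⟩)
      map_add' := fun D D' => by
        funext μ
        ext k l
        have h : ∀ i, (Q i).blockOp (fun ν => (D + D') ⟨i, ν⟩) =
          (Q i).blockOp (fun ν => D ⟨i, ν⟩) + (Q i).blockOp (fun ν => D' ⟨i, ν⟩) :=
            fun i => (Q i).blockOp_add _ _
        exact (Finset.sum_congr rfl fun i _ => by rw [h i, LinearMap.comp_add, map_add]).trans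
          Finset.sum_add_distrib
      map_smul' := fun c D => by
        funext μ
        ext k l
        have h : ∀ i, (Q i).blockOp (fun ν => (c • D) ⟨i, ν⟩) =
          c • (Q i).blockOp (fun ν => D ⟨i, ν⟩) := fun i => (Q i).blockOp_smul _ _
        exact (Finset.sum_congr rfl fun i _ => by rw [h i, LinearMap.comp_smul, map_smul]).trans
          Finset.smul_sum.symm }
  have hLapply : ∀ D μ k l, L D μ k l = ∑ i, LinearMap.trace ℂ H
      (R.intertwiner μ k l ∘ₗ (Q i).blockOp fun ν => D ⟨i, ν⟩) := fun _ _ _ _ => rfl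
  -- This makes the kernel of `L` closed under adjoints. Cyclicity of the trace undoes the reversal
  -- of the product.
  have hLstar : ∀ D μ k l, L (fun ω => (D ω)ᴴ) μ k l = star (L D μ l k) := fun D μ k l => by
    rw [hLapply, hLapply, star_sum]
    refine Finset.sum_congr rfl fun i _ => ?_
    rw [← LinearMap.trace_adjoint, LinearMap.adjoint_comp, R.intertwiner_adjoint,
      ← (Q i).blockOp_conjTranspose, LinearMap.trace_comp_comm']
  have hfin : Module.finrank ℂ R.Blocks = ∑ μ, R.mult μ ^ 2 := by
    simp [Module.finrank_pi_fintype, Module.finrank_matrix, pow_two]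
  obtain ⟨D, hD0, hLD, hpos⟩ := exists_perturbation_of_finrank_lt
    (fun ω : (Σ i, (Q i).ι) => X ω.1 ω.2) L
    (fun D hD => by
      funext μ
      ext k l
      rw [hLstar, hD]
      simp)
    (by rwa [hfin, Fintype.sum_sigma])
  refine ⟨fun i ν => D ⟨i, ν⟩, fun h => hD0 ?_, fun μ k l => ?_, fun i ν => hpos ⟨i, ν⟩⟩
  · funext ω
    exact congrFun (congrFun h ω.1) ω.2
  · rw [← hLapply, hLD]
    rfl

/-- The rank bound for the extreme points of the set of normalized block operators. -/
theorem sum_rank_sq_le_of_mem_extremePoints_normalizedBlocks (R : IrrepDecomposition U.toFun)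
    (Q : ∀ i, IrrepDecomposition fun h : K i => U.toFun h) (n : ∀ i, (Q i).ι → ℕ)
    (X : ∀ i (ν : (Q i).ι), Matrix (Fin (n i ν)) (Fin ((Q i).mult ν)) ℂ)
    (hX : (fun i ν => (X i ν)ᴴ * X i ν : BlockOperators Q) ∈
      Set.extremePoints ℝ (normalizedBlocks R Q)) :
    ∑ i, ∑ ν, (X i ν).rank ^ 2 ≤ ∑ μ, R.mult μ ^ 2 := by
  by_contra! hlt
  obtain ⟨D, hD0, hD, hpos⟩ := exists_block_perturbation R Q n X hlt
  simp only [IrrepDecomposition.trace_comp_blockOp] at hD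
  refine hD0 (eq_zero_of_add_mem_of_sub_mem_of_mem_extremePoints hX
    ⟨fun i ν => (hpos i ν).1, fun μ k l => ?_⟩ ⟨fun i ν => (hpos i ν).2, fun μ k l => ?_⟩)
  · rw [← hX.1.2 μ k l]
    simp [Matrix.mul_add, Finset.sum_add_distrib, hD]
  · rw [← hX.1.2 μ k l]
    simp [Matrix.mul_sub, Finset.sum_sub_distrib, hD]

end

/-! ### Conjugation by the representation and integrals over `G ⧸ K`. -/

section

variable {H : Type*} [NormedAddCommGroup H] [InnerProductSpace ℂ H]

theorem conjUnitary_apply (u : H ≃ₗᵢ[ℂ] H) (A : H →L[ℂ] H) (v : H) :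
    conjUnitary u A v = u (A (u.symm v)) := rfl

theorem conjUnitary_eq_of_commute {u : H ≃ₗᵢ[ℂ] H} {A : H →L[ℂ] H}
    (h : ∀ v, A (u v) = u (A v)) : conjUnitary u A = A := by
  ext v
  rw [conjUnitary_apply, ← h, LinearIsometryEquiv.apply_symm_apply]

theorem commute_of_conjUnitary_eq {u : H ≃ₗᵢ[ℂ] H} {A : H →L[ℂ] H}
    (h : conjUnitary u A = A) (v : H) : A (u v) = u (A v) := by
  conv_lhs => rw [← h]
  rw [conjUnitary_apply, LinearIsometryEquiv.symm_apply_apply]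

/-- Conjugation by a unitary as a continuous linear map. -/
noncomputable def conjUnitaryL (u : H ≃ₗᵢ[ℂ] H) : (H →L[ℂ] H) →L[ℂ] (H →L[ℂ] H) :=
  (ContinuousLinearMap.compL ℂ H H H (u.toContinuousLinearEquiv : H →L[ℂ] H)) ∘L
    ((ContinuousLinearMap.compL ℂ H H H).flip (u.symm.toContinuousLinearEquiv : H →L[ℂ] H))

theorem conjUnitaryL_apply (u : H ≃ₗᵢ[ℂ] H) (A : H →L[ℂ] H) :
    conjUnitaryL u A = conjUnitary u A := rfl

theorem conjUnitary_add (u : H ≃ₗᵢ[ℂ] H) (A B : H →L[ℂ] H) :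
    conjUnitary u (A + B) = conjUnitary u A + conjUnitary u B := map_add (conjUnitaryL u) A B

theorem conjUnitary_nonneg (u : H ≃ₗᵢ[ℂ] H) {A : H →L[ℂ] H} (hA : 0 ≤ A) :
    0 ≤ conjUnitary u A := by
  rw [ContinuousLinearMap.nonneg_iff_isPositive, ContinuousLinearMap.isPositive_iff_complex] at *
  intro v
  have h : inner ℂ (conjUnitary u A v) v = inner ℂ (A (u.symm v)) (u.symm v) := by
    rw [conjUnitary_apply, ← u.inner_map_map (A (u.symm v)), u.apply_symm_apply]
  rw [h]
  exact hA _

variable {G : Type*} [Group G] [TopologicalSpace G] (U : ProjectiveUnitaryRep G H)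

/-- The phase of the multiplier cancels against its inverse, so conjugation is a genuine action. -/
theorem ProjectiveUnitaryRep.conjUnitary_mul (g h : G) (A : H →L[ℂ] H) :
    conjUnitary (U.toFun (g * h)) A = conjUnitary (U.toFun g) (conjUnitary (U.toFun h) A) := by
  obtain ⟨c, hc, hmul⟩ := U.multiplier g h
  have hc0 : c ≠ 0 := fun h0 => by simp [h0] at hc
  ext v
  obtain ⟨w, rfl⟩ := (U.toFun (g * h)).surjective v
  have h1 : (U.toFun h).symm ((U.toFun g).symm (U.toFun (g * h) w)) = c⁻¹ • w := by
    rw [LinearIsometryEquiv.symm_apply_eq, LinearIsometryEquiv.symm_apply_eq, map_smul, map_smul,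
      hmul, smul_smul, inv_mul_cancel₀ hc0, one_smul]
  simp only [conjUnitary_apply, h1, LinearIsometryEquiv.symm_apply_apply, map_smul]
  rw [hmul, smul_smul, inv_mul_cancel₀ hc0, one_smul]

theorem ProjectiveUnitaryRep.conjUnitary_out {K : Subgroup G} {A : H →L[ℂ] H}
    (hA : ∀ h : K, conjUnitary (U.toFun h) A = A) (g : G) :
    conjUnitary (U.toFun (QuotientGroup.mk g : G ⧸ K).out) A = conjUnitary (U.toFun g) A := by
  obtain ⟨h, hh⟩ := QuotientGroup.mk_out_eq_mul K g
  rw [hh, U.conjUnitary_mul, hA]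

variable [MeasurableSpace G] [IsTopologicalGroup G] [CompactSpace G] [BorelSpace G]
  [FiniteDimensional ℂ H]

instance : IsProbabilityMeasure
    (Measure.haarMeasure (⊤ : TopologicalSpace.PositiveCompacts G)) :=
  ⟨Measure.haarMeasure_self⟩

theorem ProjectiveUnitaryRep.integrable_conjUnitary (A : H →L[ℂ] H) :
    Integrable (fun g => conjUnitary (U.toFun g) A)
      (Measure.haarMeasure (⊤ : TopologicalSpace.PositiveCompacts G)) := by
  obtain ⟨C, hC⟩ := (isCompact_range (U.continuous_conj A)).isBounded.exists_norm_le
  have : ProperSpace (H →L[ℂ] H) := FiniteDimensional.proper ℂ _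
  exact Integrable.of_bound (U.continuous_conj A).measurable.aestronglyMeasurable C
    (Filter.Eventually.of_forall fun g => hC _ ⟨g, rfl⟩)

-- `Quotient.out` need not be measurable. Measurability is tested after pulling back to `G`, where
-- the choice of representative disappears and the density is continuous.
omit [IsTopologicalGroup G] [CompactSpace G] in
theorem ProjectiveUnitaryRep.stronglyMeasurable_conjUnitary_out {K : Subgroup G} {A : H →L[ℂ] H}
    (hA : ∀ h : K, conjUnitary (U.toFun h) A = A) :
    StronglyMeasurable fun x : G ⧸ K => conjUnitary (U.toFun x.out) A := by
  have : ProperSpace (H →L[ℂ] H) := FiniteDimensional.proper ℂ _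
  refine Measurable.stronglyMeasurable (QuotientGroup.measurable_from_quotient.mpr ?_)
  have h : ((fun x : G ⧸ K => conjUnitary (U.toFun x.out) A) ∘ QuotientGroup.mk) =
    fun g => conjUnitary (U.toFun g) A := funext fun g => U.conjUnitary_out hA g
  rw [h]
  exact (U.continuous_conj A).measurable

theorem ProjectiveUnitaryRep.integrable_conjUnitary_out {K : Subgroup G} {A : H →L[ℂ] H}
    (hA : ∀ h : K, conjUnitary (U.toFun h) A = A) :
    Integrable (fun x : G ⧸ K => conjUnitary (U.toFun x.out) A) (invariantMeasure K) := by
  rw [invariantMeasure, integrable_map_measure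
    (U.stronglyMeasurable_conjUnitary_out hA).aestronglyMeasurable
    QuotientGroup.measurable_coe.aemeasurable]
  exact (U.integrable_conjUnitary A).congr
    (Filter.Eventually.of_forall fun g => (U.conjUnitary_out hA g).symm)

/-- Integrals over subsets of `G ⧸ K` are integrals over their preimages in `G`. -/
theorem ProjectiveUnitaryRep.setIntegral_conjUnitary_out {K : Subgroup G} {A : H →L[ℂ] H}
    (hA : ∀ h : K, conjUnitary (U.toFun h) A = A) {B : Set (G ⧸ K)} (hB : MeasurableSet B) :
    ∫ x in B, conjUnitary (U.toFun x.out) A ∂(invariantMeasure K) =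
      ∫ g in QuotientGroup.mk ⁻¹' B, conjUnitary (U.toFun g) A
        ∂(Measure.haarMeasure (⊤ : TopologicalSpace.PositiveCompacts G)) := by
  rw [invariantMeasure, setIntegral_map hB
    (U.stronglyMeasurable_conjUnitary_out hA).aestronglyMeasurable
    QuotientGroup.measurable_coe.aemeasurable]
  simp only [U.conjUnitary_out hA]

/-- A linear functional that is nonnegative on the integrals of the density is nonnegative on the
seed. -/
theorem ProjectiveUnitaryRep.nonneg_of_forall_setIntegral_nonneg {K : Subgroup G}
    {A : H →L[ℂ] H} (hA : ∀ h : K, conjUnitary (U.toFun h) A = A) (f : (H →L[ℂ] H) →L[ℝ] ℝ)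
    (hf : ∀ B : Set (G ⧸ K), MeasurableSet B →
      0 ≤ f (∫ x in B, conjUnitary (U.toFun x.out) A ∂(invariantMeasure K))) :
    0 ≤ f A := by
  have hint := U.integrable_conjUnitary_out hA
  have hae : 0 ≤ᵐ[invariantMeasure K] fun x => f (conjUnitary (U.toFun x.out) A) := by
    refine ae_nonneg_of_forall_setIntegral_nonneg (f.integrable_comp hint) fun B hB _ => ?_
    rw [f.integral_comp_comm hint.integrableOn]
    exact hf B hB
  have hae' := ae_of_ae_map QuotientGroup.measurable_coe.aemeasurable hae
  -- The set of violations is open and null, and Haar measure charges nonempty open sets. So the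
  -- inequality holds everywhere, in particular at `g = 1`.
  have hopen : IsOpen {g : G | f (conjUnitary (U.toFun g) A) < 0} :=
    isOpen_lt (f.continuous.comp (U.continuous_conj A)) continuous_const
  have hnull : Measure.haarMeasure (⊤ : TopologicalSpace.PositiveCompacts G)
      {g : G | f (conjUnitary (U.toFun g) A) < 0} = 0 := by
    rw [← nonpos_iff_eq_zero, ← ae_iff.mp hae']
    refine measure_mono fun g hg => ?_
    simpa [U.conjUnitary_out hA] using hg
  rw [hopen.measure_eq_zero_iff (Measure.haarMeasure ⊤)] at hnull
  -- `U 1` may be a nontrivial phase; invariance under `1 ∈ K` suffices.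
  have h1 : conjUnitary (U.toFun 1) A = A := hA 1
  by_contra! hneg
  have : (1 : G) ∈ {g : G | f (conjUnitary (U.toFun g) A) < 0} := by simpa [h1] using hneg
  rw [hnull] at this
  exact this

end

/-! ### Seeds and the operator-valued measures they generate. -/

section

variable {G : Type*} [Group G] [TopologicalSpace G]
  {H : Type*} [NormedAddCommGroup H] [InnerProductSpace ℂ H] [FiniteDimensional ℂ H]
  {I : Type*} {U : ProjectiveUnitaryRep G H} {K : I → Subgroup G}
  {Q : ∀ i, IrrepDecomposition fun h : K i => U.toFun h}

/-- The seed `A_i = ⨁_ν 1 ⊗ A_{i,ν}`. -/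
noncomputable def seedOp (A : BlockOperators Q) (i : I) : H →L[ℂ] H :=
  LinearMap.toContinuousLinearMap ((Q i).blockOp (A i))

theorem seedOp_add (A D : BlockOperators Q) (i : I) :
    seedOp (A + D) i = seedOp A i + seedOp D i := by
  rw [seedOp, Pi.add_apply, IrrepDecomposition.blockOp_add, map_add]
  rfl

theorem seedOp_smul (c : ℂ) (A : BlockOperators Q) (i : I) :
    seedOp (c • A) i = c • seedOp A i := by
  rw [seedOp, Pi.smul_apply, IrrepDecomposition.blockOp_smul, map_smul]
  rfl

theorem conjUnitary_seedOp (A : BlockOperators Q) (i : I) (h : K i) :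
    conjUnitary (U.toFun h) (seedOp A i) = seedOp A i :=
  conjUnitary_eq_of_commute ((Q i).blockOp_commute (A i) h)

theorem seedOp_nonneg_iff (A : BlockOperators Q) (i : I) :
    0 ≤ seedOp A i ↔ ∀ ν, (A i ν).PosSemidef := by
  rw [ContinuousLinearMap.nonneg_iff_isPositive, seedOp,
    LinearMap.isPositive_toContinuousLinearMap_iff, IrrepDecomposition.isPositive_blockOp_iff]

variable [MeasurableSpace G]

theorem measurable_sigma_mk {ι : Type*} {Y : ι → Type*} [∀ i, MeasurableSpace (Y i)] (i : ι) :
    Measurable (Sigma.mk i : Y i → Σ i, Y i) :=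
  measurable_iff_le_map.mpr (iInf_le _ i)

theorem measurableSet_sigma_iff {ι : Type*} {Y : ι → Type*} [∀ i, MeasurableSpace (Y i)]
    {B : Set (Σ i, Y i)} : MeasurableSet B ↔ ∀ i, MeasurableSet (Sigma.mk i ⁻¹' B) :=
  MeasurableSpace.measurableSet_iInf

variable [IsTopologicalGroup G] [CompactSpace G] [BorelSpace G] [Fintype I]

/-- Lifting the integrals to `G` removes the representatives and makes the translation invariance of
Haar measure available. -/
theorem hasSeeds_iff {P : VectorMeasure (OutcomeSpace K) (H →L[ℂ] H)} {A : BlockOperators Q} :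
    HasSeeds P A ↔ ∀ B : Set (OutcomeSpace K), MeasurableSet B →
      P B = ∑ i, ∫ g in {g : G | (⟨i, g⟩ : OutcomeSpace K) ∈ B},
        conjUnitary (U.toFun g) (seedOp A i)
          ∂(Measure.haarMeasure (⊤ : TopologicalSpace.PositiveCompacts G)) := by
  refine forall₂_congr fun B hB => ?_
  have h : ∀ i, ∫ x in {x : G ⧸ K i | (⟨i, x⟩ : OutcomeSpace K) ∈ B},
      conjUnitary (U.toFun x.out) (LinearMap.toContinuousLinearMap ((Q i).blockOp (A i)))
        ∂(invariantMeasure (K i)) = ∫ g in {g : G | (⟨i, g⟩ : OutcomeSpace K) ∈ B},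
        conjUnitary (U.toFun g) (seedOp A i)
          ∂(Measure.haarMeasure (⊤ : TopologicalSpace.PositiveCompacts G)) := fun i =>
    U.setIntegral_conjUnitary_out (conjUnitary_seedOp A i) (measurableSet_sigma_iff.mp hB i)
  simp only [h]

/-- Every block operator is the seed of an operator-valued measure. -/
theorem exists_hasSeeds (A : BlockOperators Q) :
    ∃ P : VectorMeasure (OutcomeSpace K) (H →L[ℂ] H), HasSeeds P A := by
  classical
  refine ⟨∑ i, ((invariantMeasure (K i)).withDensityᵥ fun x =>
    conjUnitary (U.toFun x.out) (seedOp A i)).map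
      fun x => (⟨i, x⟩ : OutcomeSpace K), fun B hB => ?_⟩
  have h : ∀ s : Finset I, (∑ i ∈ s, ((invariantMeasure (K i)).withDensityᵥ fun x =>
      conjUnitary (U.toFun x.out) (seedOp A i)).map
        (fun x => (⟨i, x⟩ : OutcomeSpace K)) :
        VectorMeasure (OutcomeSpace K) (H →L[ℂ] H)) B =
      ∑ i ∈ s, ∫ x in {x : G ⧸ K i | (⟨i, x⟩ : OutcomeSpace K) ∈ B},
        conjUnitary (U.toFun x.out) (seedOp A i) ∂(invariantMeasure (K i)) := fun s => by
    induction s using Finset.induction_on with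
    | empty => simp
    | insert i s hi ih =>
      rw [Finset.sum_insert hi, Finset.sum_insert hi, _root_.add_apply, ih,
        VectorMeasure.map_apply _ (measurable_sigma_mk i) hB,
        withDensityᵥ_apply (U.integrable_conjUnitary_out (conjUnitary_seedOp A i))
          (measurable_sigma_mk i hB)]
      rfl
  exact h Finset.univ

namespace HasSeeds

variable {P N : VectorMeasure (OutcomeSpace K) (H →L[ℂ] H)} {A D : BlockOperators Q}

theorem add (hP : HasSeeds P A) (hN : HasSeeds N D) : HasSeeds (P + N) (A + D) := by
  rw [hasSeeds_iff] at *
  intro B hB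
  rw [_root_.add_apply, hP B hB, hN B hB, ← Finset.sum_add_distrib]
  refine Finset.sum_congr rfl fun i _ => ?_
  rw [← integral_add (U.integrable_conjUnitary _).integrableOn
    (U.integrable_conjUnitary _).integrableOn]
  simp only [seedOp_add, conjUnitary_add]

theorem neg (hN : HasSeeds N D) : HasSeeds (-N) (-D) := by
  rw [hasSeeds_iff] at *
  intro B hB
  rw [_root_.neg_apply, hN B hB, ← Finset.sum_neg_distrib]
  refine Finset.sum_congr rfl fun i _ => ?_
  rw [← integral_neg]
  have h : seedOp (-D) i = -seedOp D i := by rw [← neg_one_smul ℂ D, seedOp_smul, neg_one_smul]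
  simp only [h, ← conjUnitaryL_apply, map_neg]

theorem sub (hP : HasSeeds P A) (hN : HasSeeds N D) : HasSeeds (P - N) (A - D) := by
  rw [sub_eq_add_neg, sub_eq_add_neg]
  exact hP.add hN.neg

/-- An operator-valued measure with seeds is covariant. -/
theorem covariant (hP : HasSeeds P A) (g : G) {B : Set (OutcomeSpace K)}
    (hB : MeasurableSet B) : P (g • B) = conjUnitary (U.toFun g) (P B) := by
  have hmem : ∀ i (h : G), (⟨i, (g * h : G)⟩ : OutcomeSpace K) ∈ g • B ↔
      (⟨i, h⟩ : OutcomeSpace K) ∈ B := fun i h =>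
    Set.smul_mem_smul_set_iff (a := g) (s := B) (x := (⟨i, h⟩ : OutcomeSpace K))
  -- Measurability in a quotient is checked on preimages in `G`, where `g •` is a left translation.
  have hgB : MeasurableSet (g • B) := by
    rw [measurableSet_sigma_iff] at hB ⊢
    intro i
    have h1 : MeasurableSet {h : G | (⟨i, h⟩ : OutcomeSpace K) ∈ B} :=
      QuotientGroup.measurable_coe (hB i)
    have h2 := measurable_const_mul g⁻¹ h1
    refine measurableSet_quotient.mpr ?_
    convert h2 using 1
    ext h
    have := hmem i (g⁻¹ * h)
    rw [mul_inv_cancel_left] at this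
    exact this
  have hseeds := hasSeeds_iff.mp hP
  rw [hseeds _ hgB, hseeds _ hB, ← conjUnitaryL_apply, map_sum]
  refine Finset.sum_congr rfl fun i _ => ?_
  rw [← (conjUnitaryL (U.toFun g)).integral_comp_comm (U.integrable_conjUnitary _).integrableOn,
    ← (measurePreserving_mul_left (Measure.haarMeasure ⊤) g).setIntegral_preimage_emb
      (measurableEmbedding_mulLeft g)]
  simp only [conjUnitaryL_apply, U.conjUnitary_mul]
  congr 2
  ext h
  exact hmem i h

/-- An operator-valued measure with positive seeds is positive. -/
theorem nonneg (hP : HasSeeds P A) (hA : ∀ i ν, (A i ν).PosSemidef)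
    {B : Set (OutcomeSpace K)} (hB : MeasurableSet B) : 0 ≤ P B := by
  rw [hasSeeds_iff.mp hP B hB]
  exact Finset.sum_nonneg fun i _ => integral_nonneg fun g =>
    conjUnitary_nonneg _ ((seedOp_nonneg_iff A i).mpr (hA i))

/-- The seeds of a positive operator-valued measure are positive. -/
theorem posSemidef (hP : HasSeeds P A) (hpos : ∀ B, MeasurableSet B → 0 ≤ P B) (i : I)
    (ν : (Q i).ι) : (A i ν).PosSemidef := by
  classical
  -- Testing `P` on sets inside the single component `i` isolates the `i`-th integral.
  have hint : ∀ B : Set (G ⧸ K i), MeasurableSet B →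
      0 ≤ ∫ x in B, conjUnitary (U.toFun x.out) (seedOp A i) ∂(invariantMeasure (K i)) := by
    intro B hB
    have hself : {x : G ⧸ K i | (⟨i, x⟩ : OutcomeSpace K) ∈ Sigma.mk i '' B} = B :=
      Function.Injective.preimage_image (f := fun x : G ⧸ K i => (⟨i, x⟩ : OutcomeSpace K))
        (sigma_mk_injective (β := fun j => G ⧸ K j)) B
    have hne : ∀ j, j ≠ i →
        {x : G ⧸ K j | (⟨j, x⟩ : OutcomeSpace K) ∈ Sigma.mk i '' B} = ∅ := fun j hj => by
      refine Set.eq_empty_of_forall_notMem fun x hx => ?_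
      obtain ⟨y, -, hy⟩ := hx
      exact hj (congrArg Sigma.fst hy).symm
    have hmeas : MeasurableSet (Sigma.mk i '' B : Set (OutcomeSpace K)) := by
      refine measurableSet_sigma_iff.mpr fun j => ?_
      by_cases hj : j = i
      · subst hj
        change MeasurableSet {x : G ⧸ K j | (⟨j, x⟩ : OutcomeSpace K) ∈ Sigma.mk j '' B}
        rwa [hself]
      · change MeasurableSet {x : G ⧸ K j | (⟨j, x⟩ : OutcomeSpace K) ∈ Sigma.mk i '' B}
        rw [hne j hj]
        exact MeasurableSet.empty
    have h1 := hpos _ hmeas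
    rw [hP _ hmeas, Finset.sum_eq_single i] at h1
    · rwa [hself] at h1
    · intro j _ hj
      rw [hne j hj]
      simp
    · simp
  have hf : ∀ f : (H →L[ℂ] H) →L[ℝ] ℝ, (∀ O, 0 ≤ O → 0 ≤ f O) → 0 ≤ f (seedOp A i) :=
    fun f hf => U.nonneg_of_forall_setIntegral_nonneg (conjUnitary_seedOp A i) f
      fun B hB => hf _ (hint B hB)
  refine (seedOp_nonneg_iff A i).mp ?_ ν
  rw [ContinuousLinearMap.nonneg_iff_isPositive, ContinuousLinearMap.isPositive_iff_complex]
  intro v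
  -- The real part of `F` and both signs of its imaginary part are nonnegative on positive
  -- operators. Hence `F` takes a real nonnegative value at the seed.
  let F : (H →L[ℂ] H) →L[ℝ] ℂ :=
    ((innerSL ℂ v) ∘L (ContinuousLinearMap.apply ℂ H v)).restrictScalars ℝ
  have hF : ∀ O, F O = inner ℂ v (O v) := fun _ => rfl
  have hFpos : ∀ O, 0 ≤ O → 0 ≤ F O := fun O hO => by
    rw [ContinuousLinearMap.nonneg_iff_isPositive] at hO
    exact hO.inner_nonneg_right v
  have hre := hf (Complex.reCLM ∘L F) fun O hO => (Complex.le_def.mp (hFpos O hO)).1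
  have him := hf (Complex.imCLM ∘L F) fun O hO => (Complex.le_def.mp (hFpos O hO)).2.le
  have him' := hf (-(Complex.imCLM ∘L F)) fun O hO => by
    simpa using (Complex.le_def.mp (hFpos O hO)).2.ge
  have him0 : (F (seedOp A i)).im = 0 := le_antisymm (by simpa using him') him
  have hinner : inner ℂ (seedOp A i v) v = F (seedOp A i) := by
    rw [hF, ← inner_conj_symm, ← hF]
    exact Complex.conj_eq_iff_im.mpr him0
  rw [hinner]
  exact ⟨Complex.ext rfl him0.symm, hre⟩

/-- The total mass is fixed by the traces of the seeds against the intertwiners. -/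
theorem univ_eq_zero (hN : HasSeeds N D) (R : IrrepDecomposition U.toFun)
    (hD : ∀ μ k l,
      ∑ i, LinearMap.trace ℂ H (R.intertwiner μ k l ∘ₗ (Q i).blockOp (D i)) = 0) :
    N Set.univ = 0 := by
  have hcomm : ∀ g, conjUnitary (U.toFun g) (N Set.univ) = N Set.univ := fun g => by
    rw [← hN.covariant g MeasurableSet.univ, Set.smul_set_univ]
  suffices h : (N Set.univ : H →ₗ[ℂ] H) = 0 by
    ext v
    exact LinearMap.congr_fun h v
  refine R.eq_zero_of_trace_intertwiner_comp _
    (fun g v => commute_of_conjUnitary_eq (hcomm g) v) fun μ k l => ?_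
  let t : (H →L[ℂ] H) →L[ℂ] ℂ := LinearMap.toContinuousLinearMap
    (LinearMap.trace ℂ H ∘ₗ LinearMap.llcomp ℂ H H H (R.intertwiner μ k l) ∘ₗ
      (LinearMap.toContinuousLinearMap (𝕜 := ℂ) (E := H) (F' := H)).symm.toLinearMap)
  have ht : ∀ O : H →L[ℂ] H,
      t O = LinearMap.trace ℂ H (R.intertwiner μ k l ∘ₗ (O : H →ₗ[ℂ] H)) := fun _ => rfl
  -- Invariance of `t` under conjugation makes the integrand constant, so the integral over the
  -- probability measure is `t` of the seed.
  have htconj : ∀ g O, t (conjUnitary (U.toFun g) O) = t O := fun g O => by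
    rw [ht, ht]
    have h1 : R.intertwiner μ k l ∘ₗ (conjUnitary (U.toFun g) O : H →ₗ[ℂ] H) =
        ((U.toFun g).toLinearEquiv : H →ₗ[ℂ] H) ∘ₗ (R.intertwiner μ k l ∘ₗ (O : H →ₗ[ℂ] H)) ∘ₗ
          ((U.toFun g).symm.toLinearEquiv : H →ₗ[ℂ] H) := by
      refine LinearMap.ext fun v => ?_
      change R.intertwiner μ k l (U.toFun g (O ((U.toFun g).symm v))) =
        U.toFun g (R.intertwiner μ k l (O ((U.toFun g).symm v)))
      exact R.blockOp_commute _ g _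
    have h2 : ((U.toFun g).symm.toLinearEquiv : H →ₗ[ℂ] H) ∘ₗ
        ((U.toFun g).toLinearEquiv : H →ₗ[ℂ] H) = LinearMap.id :=
      LinearMap.ext fun v => (U.toFun g).symm_apply_apply v
    rw [h1, LinearMap.trace_comp_comm', LinearMap.comp_assoc, h2, LinearMap.comp_id]
  rw [← ht, hasSeeds_iff.mp hN _ MeasurableSet.univ, map_sum, ← hD μ k l]
  refine Finset.sum_congr rfl fun i _ => ?_
  rw [← t.integral_comp_comm (U.integrable_conjUnitary _).integrableOn]
  simp only [htconj, Set.mem_univ, Set.ofPred_true, Measure.restrict_univ, integral_const,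
    probReal_univ, one_smul]
  exact ht _

end HasSeeds

/-! ### The bound for extreme covariant POVMs and the main theorem. -/

/-- The rank bound for the extreme covariant POVMs. -/
theorem sum_rank_sq_le_of_mem_extremePoints_covariantPOVMs (R : IrrepDecomposition U.toFun)
    {P : VectorMeasure (OutcomeSpace K) (H →L[ℂ] H)}
    (hP : P ∈ Set.extremePoints ℝ (covariantPOVMs U K)) {A : BlockOperators Q}
    (hA : HasSeeds P A) : ∑ i, ∑ ν, (A i ν).rank ^ 2 ≤ ∑ μ, R.mult μ ^ 2 := by
  by_contra! hlt
  have hApos := hA.posSemidef fun B hB => (hP.1.1 B hB).1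
  choose X hX using fun i ν => (hApos i ν).exists_eq_conjTranspose_mul_self
  obtain ⟨D, hD0, hD, hpos⟩ := exists_block_perturbation R Q (fun i ν => (Q i).mult ν) X
    (by simpa only [hX, Matrix.rank_conjTranspose_mul_self] using hlt)
  simp only [← hX] at hpos
  obtain ⟨N, hN⟩ := exists_hasSeeds D
  have hN0 := hN.univ_eq_zero R hD
  have hmem : ∀ {P' : VectorMeasure (OutcomeSpace K) (H →L[ℂ] H)} {A' : BlockOperators Q},
      HasSeeds P' A' → (∀ i ν, (A' i ν).PosSemidef) → P' Set.univ = 1 →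
        P' ∈ covariantPOVMs U K := by
    intro P' A' hP' hA' huniv
    refine ⟨fun B hB => ⟨hP'.nonneg hA' hB, ?_⟩, huniv, fun g B hB => hP'.covariant g hB⟩
    -- The upper bound `P' B ≤ 1` follows from positivity on the complement of `B`.
    rw [← huniv, ← Set.union_compl_self B,
      VectorMeasure.of_union disjoint_compl_right hB hB.compl]
    exact le_add_of_nonneg_right (hP'.nonneg hA' hB.compl)
  have hzero : N = 0 := eq_zero_of_add_mem_of_sub_mem_of_mem_extremePoints hP
    (hmem (hA.add hN) (fun i ν => (hpos i ν).1) (by simp [hN0, hP.1.2.1]))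
    (hmem (hA.sub hN) (fun i ν => (hpos i ν).2) (by simp [hN0, hP.1.2.1]))
  -- The zero measure has both `D` and `-D` as seeds, and it is positive, so both are positive
  -- semidefinite.
  have h1 := hN.posSemidef fun B _ => by simp [hzero]
  have h2 := hN.neg.posSemidef fun B _ => by simp [hzero]
  refine hD0 (funext fun i => funext fun ν => ?_)
  exact (h1 i ν).eq_zero_of_neg (h2 i ν)

end

theorem mainTheorem3
    {G : Type*} [Group G] [TopologicalSpace G] [IsTopologicalGroup G] [CompactSpace G]
    [T2Space G] [MeasurableSpace G] [BorelSpace G]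
    {H : Type*} [NormedAddCommGroup H] [InnerProductSpace ℂ H] [FiniteDimensional ℂ H]
    (U : ProjectiveUnitaryRep G H)
    {I : Type*} [Fintype I] (K : I → Subgroup G) (hK : ∀ i, IsClosed (K i : Set G))
    (R : IrrepDecomposition U.toFun)
    (Q : ∀ i, IrrepDecomposition fun h : K i => U.toFun h) :
    (∀ (n : ∀ i, (Q i).ι → ℕ)
        (X : ∀ i (ν : (Q i).ι), Matrix (Fin (n i ν)) (Fin ((Q i).mult ν)) ℂ),
      (fun i ν => (X i ν)ᴴ * X i ν : BlockOperators Q) ∈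
        Set.extremePoints ℝ (normalizedBlocks R Q) →
      ∑ i, ∑ ν, (X i ν).rank ^ 2 ≤ ∑ μ, R.mult μ ^ 2) ∧
    (∀ P ∈ Set.extremePoints ℝ (covariantPOVMs U K), ∀ A : BlockOperators Q, HasSeeds P A →
      ∑ i, ∑ ν, (A i ν).rank ^ 2 ≤ ∑ μ, R.mult μ ^ 2) := by
  exact ⟨fun n X hX => sum_rank_sq_le_of_mem_extremePoints_normalizedBlocks R Q n X hX,
    fun _ hP _ hA => sum_rank_sq_le_of_mem_extremePoints_covariantPOVMs R hP hA⟩
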